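/- **Theorem D (Random pointwise $\ell$-averaging theorem).** Let $\ell$ be a positive integer, let $(u_n)$ be a sequence of probabilities that is non-increasing for $n\ge 1$, $u_1\ge u_2\ge\dots$, and let $(U_n)$ be independent $0$-$1$ valued random variables on a probability space $(\Omega,P)$ with $P(U_n=1)=u_n=1-P(U_n=0)$. Suppose that for some $\delta>0$ $$u_n\cdot\frac{n^{1/(\ell+1)}}{\log^{2+\delta}n}\to\infty\qquad(n\to\infty).$$ Then there is a set $\Omega'\subset\Omega$ with $P(\Omega')=1$ such that for every $\omega\in\Omega'$ the following holds: for every probability space $(X,\mu)$ with a measurable, measure preserving transformation $T:X\to X$, and for all bounded measurable (real or complex valued) functions $F_1,\dots,F_\ell$ on $X$, $$\lim_{N\to\infty}\frac{1}{\sum_{n<N}U_n(\omega)}\sum_{n<N}\bigl(U_n(\omega)-u_n\bigr)\,F_1(T^nx)\,F_2(T^{2n}x)\cdots F_\ell(T^{\ell n}x)=0\qquad\text{for $\mu$-a.e. }x\in X.$$ Here $\sum_{n<N}$ means $\sum_{0\le n<N}$, and $u_0\in[0,1]$ is arbitrary (for instance $0$, which makes the sums start at $n=1$). -/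

import Mathlib

open MeasureTheory ProbabilityTheory Filter Topology

/-- `U 0, U 1, U 2, …` are independent `0-1` valued random variables on the probability space
`(Ω, P)` with `P(U n = 1) = u n`. If `P` is a probability measure then necessarily
`0 ≤ u n ≤ 1` and `P(U n = 0) = 1 - u n`. -/
structure IsRandomIndicator {Ω : Type*} [MeasurableSpace Ω] (P : Measure Ω)
    (u : ℕ → ℝ) (U : ℕ → Ω → ℝ) : Prop where
  measurable : ∀ n, Measurable (U n)
  zero_or_one : ∀ n ω, U n ω = 0 ∨ U n ω = 1
  indep : iIndepFun U P
  law : ∀ n, P.real {ω | U n ω = 1} = u n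

/-- The product `T^n F₁(x) · T^{2n} F₂(x) ⋯ T^{ℓn} F_ℓ(x)`, where `T^k F (x) = F (T^k x)`.
The function `F_i` of the mathematical text, `1 ≤ i ≤ ℓ`, is `F j` with `(j : ℕ) + 1 = i`. -/
def multipleProduct {X : Type*} (T : X → X) {ℓ : ℕ} (F : Fin ℓ → X → ℂ) (n : ℕ) (x : X) : ℂ :=
  ∏ j : Fin ℓ, F j (T^[((j : ℕ) + 1) * n] x)

/-- The average
`(1 / ∑_{n<N} a n) ∑_{n<N} (a n - u n) · T^n F₁(x) · T^{2n} F₂(x) ⋯ T^{ℓn} F_ℓ(x)`,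
to be used with `a n = U n ω`. -/
noncomputable def differenceAverage {X : Type*} (T : X → X) {ℓ : ℕ} (F : Fin ℓ → X → ℂ)
    (a u : ℕ → ℝ) (N : ℕ) (x : X) : ℂ :=
  (∑ n ∈ Finset.range N, a n)⁻¹ •
    ∑ n ∈ Finset.range N, (a n - u n) • multipleProduct T F n x

/-!
Write `n = ∑ i, d i * q ^ i` with `ℓ + 1` digits in a base `q` of size about `N ^ (1 / (ℓ + 1))`.
Some start `h n` makes the `j`-th term of the progression `h n, h n + n, …, h n + ℓ * n`
independent of the digit `d j`, so along these progressions each of `ℓ + 1` functions takes only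
`q ^ ℓ` values.
An exponential tail bound for fixed functions and a union bound over their discretizations then
show that almost surely `∑_{n<N} (U n - u n) ∏ j, f j (h n + j * n)` is `o(w N)`, uniformly in
`f j` bounded by `1`, with `w N = ∑_{n<N} u n`: this costs `q ^ ℓ ≈ N ^ (ℓ / (ℓ + 1))` against the
exponent `w N / log ^ (2 + δ) N`.

By invariance of `μ` the shifts `h n` are invisible to integrals, and testing the multiple averages
against their own conjugates bounds their `L²` norms. These bounds are summable along the times at
which `w` first passes `b ^ k`. Between consecutive such times the sums move by at most about
`2 * (b - 1) * w`, and `b` tends to `1`.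
-/

section Concentration

variable {Ω ι : Type*} [MeasurableSpace Ω] {P : Measure Ω}

lemma mgf_le_exp_sq_mul_integral_sq [IsProbabilityMeasure P] {Y : Ω → ℝ} (hY : AEMeasurable Y P)
    {A x : ℝ} (hbound : ∀ ω, |Y ω| ≤ A) (hmean : ∫ ω, Y ω ∂P = 0) (hx : |x| * A ≤ 1) :
    mgf Y P x ≤ Real.exp (x ^ 2 * ∫ ω, Y ω ^ 2 ∂P) := by
  have hmem : ∀ᵐ ω ∂P, Y ω ∈ Set.Icc (-A) A := ae_of_all _ fun ω => abs_le.1 (hbound ω)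
  have hint : Integrable Y P := .of_mem_Icc (-A) A hY hmem
  have hlinear : Integrable (fun ω => 1 + x * Y ω) P :=
    (integrable_const 1).add (hint.const_mul x)
  have hint_sq : Integrable (fun ω => Y ω ^ 2) P :=
    .of_mem_Icc 0 (A ^ 2) (hY.pow_const 2) (ae_of_all _ fun ω =>
      ⟨sq_nonneg _, sq_le_sq' (abs_le.1 (hbound ω)).1 (abs_le.1 (hbound ω)).2⟩)
  have hquadratic : ∀ ω, Real.exp (x * Y ω) ≤ 1 + x * Y ω + x ^ 2 * Y ω ^ 2 := fun ω => by
    have hxY : |x * Y ω| ≤ 1 := by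
      rw [abs_mul]
      exact (mul_le_mul_of_nonneg_left (hbound ω) (abs_nonneg x)).trans hx
    have := (abs_le.1 (Real.abs_exp_sub_one_sub_id_le hxY)).2
    rw [mul_pow] at this
    linarith
  calc mgf Y P x ≤ ∫ ω, (1 + x * Y ω + x ^ 2 * Y ω ^ 2) ∂P :=
        integral_mono (integrable_exp_mul_of_mem_Icc hY hmem) (hlinear.add (hint_sq.const_mul _))
          hquadratic
    _ = x ^ 2 * ∫ ω, Y ω ^ 2 ∂P + 1 := by
        rw [integral_add hlinear (hint_sq.const_mul _),
          integral_add (integrable_const 1) (hint.const_mul x), integral_const_mul,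
          integral_const_mul, hmean]
        simp only [integral_const, probReal_univ, smul_eq_mul, mul_one, mul_zero, add_zero]
        ring
    _ ≤ Real.exp (x ^ 2 * ∫ ω, Y ω ^ 2 ∂P) := Real.add_one_le_exp _

lemma measureReal_sum_ge_le_exp {Y : ι → Ω → ℝ} (hindep : iIndepFun Y P)
    (hY : ∀ i, Measurable (Y i)) (hmean : ∀ i, ∫ ω, Y i ω ∂P = 0) {A : ℝ}
    (hbound : ∀ i ω, |Y i ω| ≤ A) {s : Finset ι} {V r : ℝ} (hV : ∑ i ∈ s, ∫ ω, Y i ω ^ 2 ∂P ≤ V)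
    (hr : 0 ≤ r) (hrA : r * A ≤ 2 * V) :
    P.real {ω | r ≤ ∑ i ∈ s, Y i ω} ≤ Real.exp (-(r ^ 2 / (4 * V))) := by
  have := hindep.isProbabilityMeasure
  have hV0 : 0 ≤ V := (Finset.sum_nonneg fun i _ => integral_nonneg fun ω => sq_nonneg _).trans hV
  rcases hV0.eq_or_lt with rfl | hVpos
  · simp
  have hx : 0 ≤ r / (2 * V) := by positivity
  have hxA : |r / (2 * V)| * A ≤ 1 := by
    rw [abs_of_nonneg hx, div_mul_eq_mul_div]
    exact (div_le_one (by positivity)).2 hrA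
  have hint : Integrable (fun ω => Real.exp (r / (2 * V) * (∑ i ∈ s, Y i) ω)) P :=
    hindep.integrable_exp_mul_sum hY fun i _ => integrable_exp_mul_of_mem_Icc
      (hY i).aemeasurable (ae_of_all _ fun ω => abs_le.1 (hbound i ω))
  have hmgf : mgf (∑ i ∈ s, Y i) P (r / (2 * V)) ≤ Real.exp ((r / (2 * V)) ^ 2 * V) :=
    calc mgf (∑ i ∈ s, Y i) P (r / (2 * V))
        = ∏ i ∈ s, mgf (Y i) P (r / (2 * V)) := hindep.mgf_sum hY s
      _ ≤ ∏ i ∈ s, Real.exp ((r / (2 * V)) ^ 2 * ∫ ω, Y i ω ^ 2 ∂P) :=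
          Finset.prod_le_prod (fun i _ => mgf_nonneg) fun i _ =>
            mgf_le_exp_sq_mul_integral_sq (hY i).aemeasurable (hbound i) (hmean i) hxA
      _ = Real.exp ((r / (2 * V)) ^ 2 * ∑ i ∈ s, ∫ ω, Y i ω ^ 2 ∂P) := by
          rw [← Real.exp_sum, Finset.mul_sum]
      _ ≤ Real.exp ((r / (2 * V)) ^ 2 * V) := by gcongr
  calc P.real {ω | r ≤ ∑ i ∈ s, Y i ω}
      ≤ Real.exp (-(r / (2 * V)) * r) * mgf (∑ i ∈ s, Y i) P (r / (2 * V)) := by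
        simpa only [Finset.sum_apply] using measure_ge_le_exp_mul_mgf r hx hint
    _ ≤ Real.exp (-(r / (2 * V)) * r) * Real.exp ((r / (2 * V)) ^ 2 * V) := by gcongr
    _ = Real.exp (-(r ^ 2 / (4 * V))) := by
        rw [← Real.exp_add]
        congr 1
        field_simp
        ring

/-- The vertices `±1 ± i` of a square that contains the unit disc. A discrete set of test
multipliers: the real part of `v * z` for a suitable vertex `v` dominates `‖z‖`, and functions
bounded by `1` are averages of functions with values in the vertices. -/
noncomputable def squareVertices : Finset ℂ := {⟨1, 1⟩, ⟨1, -1⟩, ⟨-1, 1⟩, ⟨-1, -1⟩}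

lemma card_squareVertices_le : squareVertices.card ≤ 4 := Finset.card_le_four

lemma norm_le_two_of_mem_squareVertices {v : ℂ} (hv : v ∈ squareVertices) : ‖v‖ ≤ 2 := by
  refine (Complex.norm_le_abs_re_add_abs_im v).trans ?_
  simp only [squareVertices, Finset.mem_insert, Finset.mem_singleton] at hv
  rcases hv with rfl | rfl | rfl | rfl <;> norm_num

lemma mem_convexHull_squareVertices {z : ℂ} (hz : ‖z‖ ≤ 1) :
    z ∈ convexHull ℝ (squareVertices : Set ℂ) := by
  have hprod : (squareVertices : Set ℂ) = ({-1, 1} : Set ℝ) ×ℂ ({-1, 1} : Set ℝ) := by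
    ext w
    simp only [squareVertices, Finset.coe_insert, Finset.coe_singleton, Set.mem_insert_iff,
      Set.mem_singleton_iff, Complex.mem_reProdIm, Complex.ext_iff]
    tauto
  rw [hprod, Complex.convexHull_reProdIm, convexHull_pair, segment_eq_Icc (by norm_num),
    Complex.mem_reProdIm]
  exact ⟨abs_le.1 ((Complex.abs_re_le_norm z).trans hz),
    abs_le.1 ((Complex.abs_im_le_norm z).trans hz)⟩

lemma exists_mem_squareVertices_norm_le_re_mul (z : ℂ) :
    ∃ v ∈ squareVertices, ‖z‖ ≤ (v * z).re := by
  have hz := Complex.norm_le_abs_re_add_abs_im z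
  rcases abs_cases z.re with ⟨hre, -⟩ | ⟨hre, -⟩ <;>
    rcases abs_cases z.im with ⟨him, -⟩ | ⟨him, -⟩
  · exact ⟨⟨1, -1⟩, by simp [squareVertices], by simp only [Complex.mul_re]; linarith⟩
  · exact ⟨⟨1, 1⟩, by simp [squareVertices], by simp only [Complex.mul_re]; linarith⟩
  · exact ⟨⟨-1, -1⟩, by simp [squareVertices], by simp only [Complex.mul_re]; linarith⟩
  · exact ⟨⟨-1, 1⟩, by simp [squareVertices], by simp only [Complex.mul_re]; linarith⟩

lemma measureReal_re_mul_sum_ge_le_exp {Z : ι → Ω → ℂ} (hindep : iIndepFun Z P)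
    (hZ : ∀ i, Measurable (Z i)) (hmean : ∀ i, ∫ ω, Z i ω ∂P = 0) {A : ℝ}
    (hbound : ∀ i ω, ‖Z i ω‖ ≤ A) {s : Finset ι} {V r : ℝ} (hV : ∑ i ∈ s, ∫ ω, ‖Z i ω‖ ^ 2 ∂P ≤ V)
    (hr : 0 ≤ r) (hrA : r * A ≤ 4 * V) {v : ℂ} (hv : ‖v‖ ≤ 2) :
    P.real {ω | r ≤ (v * ∑ i ∈ s, Z i ω).re} ≤ Real.exp (-(r ^ 2 / (16 * V))) := by
  have := hindep.isProbabilityMeasure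
  have hint : ∀ i, Integrable (Z i) P := fun i =>
    .of_bound (hZ i).aestronglyMeasurable A (ae_of_all _ (hbound i))
  have hint_sq : ∀ i, Integrable (fun ω => ‖Z i ω‖ ^ 2) P := fun i =>
    .of_bound ((hZ i).norm.pow_const 2).aestronglyMeasurable (A ^ 2) (ae_of_all _ fun ω => by
      rw [Real.norm_of_nonneg (by positivity)]
      exact pow_le_pow_left₀ (norm_nonneg _) (hbound i ω) 2)
  have hre_le : ∀ i ω, |(v * Z i ω).re| ≤ 2 * ‖Z i ω‖ := fun i ω =>
    (Complex.abs_re_le_norm _).trans (by rw [norm_mul]; gcongr)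
  have hmean_re : ∀ i, ∫ ω, (v * Z i ω).re ∂P = 0 := fun i => by
    have := integral_re ((hint i).const_mul v)
    rw [integral_const_mul, hmean i, mul_zero] at this
    simpa using this
  have hsq_le : ∀ i, ∫ ω, (v * Z i ω).re ^ 2 ∂P ≤ 4 * ∫ ω, ‖Z i ω‖ ^ 2 ∂P := fun i => by
    rw [← integral_const_mul]
    refine integral_mono_of_nonneg (ae_of_all _ fun ω => sq_nonneg _) ((hint_sq i).const_mul 4)
      (ae_of_all _ fun ω => ?_)
    calc (v * Z i ω).re ^ 2 = |(v * Z i ω).re| ^ 2 := (sq_abs _).symm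
      _ ≤ (2 * ‖Z i ω‖) ^ 2 := pow_le_pow_left₀ (abs_nonneg _) (hre_le i ω) 2
      _ = 4 * ‖Z i ω‖ ^ 2 := by ring
  have hVre : ∑ i ∈ s, ∫ ω, (v * Z i ω).re ^ 2 ∂P ≤ 4 * V :=
    (Finset.sum_le_sum fun i _ => hsq_le i).trans (by rw [← Finset.mul_sum]; gcongr)
  have htail := measureReal_sum_ge_le_exp (Y := fun i ω => (v * Z i ω).re)
    (hindep.comp (fun _ z => (v * z).re) fun _ => by fun_prop) (fun i => by fun_prop) hmean_re
    (fun i ω => (hre_le i ω).trans (mul_le_mul_of_nonneg_left (hbound i ω) zero_le_two)) hVre hr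
    (by linarith)
  simp only [Finset.mul_sum, Complex.re_sum]
  rwa [← mul_assoc, show (4 : ℝ) * 4 = 16 by norm_num] at htail

lemma measureReal_norm_sum_gt_le_exp {Z : ι → Ω → ℂ} (hindep : iIndepFun Z P)
    (hZ : ∀ i, Measurable (Z i)) (hmean : ∀ i, ∫ ω, Z i ω ∂P = 0) {A : ℝ}
    (hbound : ∀ i ω, ‖Z i ω‖ ≤ A) {s : Finset ι} {V r : ℝ} (hV : ∑ i ∈ s, ∫ ω, ‖Z i ω‖ ^ 2 ∂P ≤ V)
    (hr : 0 ≤ r) (hrA : r * A ≤ 4 * V) :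
    P.real {ω | r < ‖∑ i ∈ s, Z i ω‖} ≤ 4 * Real.exp (-(r ^ 2 / (16 * V))) := by
  have := hindep.isProbabilityMeasure
  have hcover : {ω | r < ‖∑ i ∈ s, Z i ω‖} ⊆
      ⋃ v ∈ squareVertices, {ω | r ≤ (v * ∑ i ∈ s, Z i ω).re} := fun ω hω => by
    obtain ⟨v, hv, hle⟩ := exists_mem_squareVertices_norm_le_re_mul (∑ i ∈ s, Z i ω)
    exact Set.mem_biUnion hv ((le_of_lt hω).trans hle)
  calc P.real {ω | r < ‖∑ i ∈ s, Z i ω‖}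
      ≤ ∑ v ∈ squareVertices, P.real {ω | r ≤ (v * ∑ i ∈ s, Z i ω).re} :=
        (measureReal_mono hcover (measure_ne_top _ _)).trans (measureReal_biUnion_finset_le _ _)
    _ ≤ ∑ v ∈ squareVertices, Real.exp (-(r ^ 2 / (16 * V))) :=
        Finset.sum_le_sum fun v hv => measureReal_re_mul_sum_ge_le_exp hindep hZ hmean hbound hV
          hr hrA (norm_le_two_of_mem_squareVertices hv)
    _ = squareVertices.card * Real.exp (-(r ^ 2 / (16 * V))) := by
        rw [Finset.sum_const, nsmul_eq_mul]
    _ ≤ 4 * Real.exp (-(r ^ 2 / (16 * V))) := by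
        gcongr
        exact_mod_cast card_squareVertices_le

lemma measureReal_norm_sum_ofReal_mul_gt_le_exp {Y : ι → Ω → ℝ} (hindep : iIndepFun Y P)
    (hY : ∀ i, Measurable (Y i)) (hmean : ∀ i, ∫ ω, Y i ω ∂P = 0) (hbound : ∀ i ω, |Y i ω| ≤ 1)
    {a : ι → ℂ} {A : ℝ} (hA : 0 ≤ A) (ha : ∀ i, ‖a i‖ ≤ A) {s : Finset ι} {V r : ℝ}
    (hV : ∑ i ∈ s, ∫ ω, Y i ω ^ 2 ∂P ≤ V) (hr : 0 ≤ r) (hrV : r ≤ 4 * (A * V)) :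
    P.real {ω | r < ‖∑ i ∈ s, (Y i ω : ℂ) * a i‖} ≤
      4 * Real.exp (-(r ^ 2 / (16 * (A ^ 2 * V)))) := by
  have := hindep.isProbabilityMeasure
  have hint_sq : ∀ i, Integrable (fun ω => A ^ 2 * Y i ω ^ 2) P := fun i =>
    (Integrable.of_bound ((hY i).pow_const 2).aestronglyMeasurable 1 (ae_of_all _ fun ω => by
      rw [Real.norm_eq_abs, abs_pow]
      exact pow_le_one₀ (abs_nonneg _) (hbound i ω))).const_mul _
  have hnorm : ∀ i ω, ‖(Y i ω : ℂ) * a i‖ ≤ A * |Y i ω| := fun i ω => by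
    rw [norm_mul, Complex.norm_real, Real.norm_eq_abs, mul_comm]
    gcongr
    exact ha i
  have hvariance : ∑ i ∈ s, ∫ ω, ‖(Y i ω : ℂ) * a i‖ ^ 2 ∂P ≤ A ^ 2 * V :=
    calc ∑ i ∈ s, ∫ ω, ‖(Y i ω : ℂ) * a i‖ ^ 2 ∂P ≤ ∑ i ∈ s, A ^ 2 * ∫ ω, Y i ω ^ 2 ∂P := by
          gcongr with i
          rw [← integral_const_mul]
          refine integral_mono_of_nonneg (ae_of_all _ fun ω => sq_nonneg _) (hint_sq i)
            (ae_of_all _ fun ω => ?_)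
          exact (pow_le_pow_left₀ (norm_nonneg _) (hnorm i ω) 2).trans_eq
            (by rw [mul_pow, sq_abs])
      _ ≤ A ^ 2 * V := by rw [← Finset.mul_sum]; gcongr
  refine measureReal_norm_sum_gt_le_exp (Z := fun i ω => (Y i ω : ℂ) * a i)
    (hindep.comp (fun i y => (y : ℂ) * a i) fun i => by fun_prop)
    (fun i => by fun_prop) (fun i => ?_) (A := A) (fun i ω => ?_) hvariance hr ?_
  · rw [integral_mul_const, integral_complex_ofReal, hmean i, Complex.ofReal_zero, zero_mul]
  · exact (hnorm i ω).trans (mul_le_of_le_one_right hA (hbound i ω))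
  · calc r * A ≤ 4 * (A * V) * A := by gcongr
      _ = 4 * (A ^ 2 * V) := by ring

end Concentration

section Vertices

lemma norm_multilinearMap_le_of_mem_convexHull {J F : Type*} {E : J → Type*} [Finite J]
    [∀ j, AddCommGroup (E j)] [∀ j, Module ℝ (E j)] [NormedAddCommGroup F] [NormedSpace ℝ F]
    (M : MultilinearMap ℝ E F) {S : ∀ j, Set (E j)} {B : ℝ}
    (hB : ∀ v, (∀ j, v j ∈ S j) → ‖M v‖ ≤ B) {v : ∀ j, E j}
    (hv : ∀ j, v j ∈ convexHull ℝ (S j)) : ‖M v‖ ≤ B := by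
  classical
  have := Fintype.ofFinite J
  have hpartial : ∀ t : Finset J, ∀ v : ∀ j, E j, (∀ j, v j ∈ convexHull ℝ (S j)) →
      (∀ j ∉ t, v j ∈ S j) → ‖M v‖ ≤ B := by
    intro t
    induction t using Finset.induction_on with
    | empty => exact fun v _ hvS => hB v fun j => hvS j (Finset.notMem_empty j)
    | insert a t _ ih =>
      intro v hv hvS
      have hconvex : ConvexOn ℝ Set.univ fun x => ‖M (Function.update v a x)‖ :=
        convexOn_univ_norm.comp_linearMap (M.toLinearMap v a)
      obtain ⟨x, hx, hle⟩ := (hconvex.subset (Set.subset_univ _)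
        (convex_convexHull ℝ (S a))).exists_ge_of_mem_convexHull (subset_convexHull ℝ _) (hv a)
      rw [Function.update_eq_self] at hle
      refine hle.trans (ih _ (fun j => ?_) fun j hj => ?_)
      · rcases eq_or_ne j a with rfl | hja
        · simpa only [Function.update_self] using subset_convexHull ℝ _ hx
        · simpa only [Function.update_of_ne hja] using hv j
      · rcases eq_or_ne j a with rfl | hja
        · simpa only [Function.update_self] using hx
        · simpa only [Function.update_of_ne hja] using
            hvS j (by simp only [Finset.mem_insert, hja, hj, or_self, not_false_eq_true])
  exact hpartial Finset.univ v hv fun j hj => absurd (Finset.mem_univ j) hj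

/-- The form `g ↦ ∑ i ∈ s, c i * ∏ j, g j (κ j i)` in functions `g j : σ → ℂ`, as a real
multilinear map: real linearity in each function is what convexity arguments need. -/
noncomputable def correlationForm {J ι σ : Type*} [Fintype J] (s : Finset ι) (c : ι → ℂ)
    (κ : J → ι → σ) : MultilinearMap ℝ (fun _ : J => σ → ℂ) ℂ :=
  ∑ i ∈ s, c i • (MultilinearMap.mkPiAlgebra ℝ J ℂ).compLinearMap
    fun j => LinearMap.proj (κ j i)

variable {J ι σ Ω : Type*} [Fintype J] [MeasurableSpace Ω] {P : Measure Ω}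

lemma correlationForm_apply (s : Finset ι) (c : ι → ℂ) (κ : J → ι → σ) (g : J → σ → ℂ) :
    correlationForm s c κ g = ∑ i ∈ s, c i * ∏ j, g j (κ j i) := by
  simp [correlationForm]

lemma norm_correlationForm_le_of_vertices [Finite σ] {s : Finset ι} {c : ι → ℂ} {κ : J → ι → σ}
    {B : ℝ}
    (hB : ∀ g : J → σ → ℂ, (∀ j k, g j k ∈ squareVertices) → ‖correlationForm s c κ g‖ ≤ B)
    {g : J → σ → ℂ} (hg : ∀ j k, ‖g j k‖ ≤ 1) : ‖correlationForm s c κ g‖ ≤ B := by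
  refine norm_multilinearMap_le_of_mem_convexHull (correlationForm s c κ)
    (S := fun _ => Set.univ.pi fun _ => (squareVertices : Set ℂ))
    (fun g hg => hB g fun j k => hg j k (Set.mem_univ k)) fun j => ?_
  rw [convexHull_pi]
  exact fun k _ => mem_convexHull_squareVertices (hg j k)

lemma measureReal_exists_correlationForm_gt_le [Fintype σ] {Y : ι → Ω → ℝ} (hindep : iIndepFun Y P)
    (hY : ∀ i, Measurable (Y i)) (hmean : ∀ i, ∫ ω, Y i ω ∂P = 0) (hbound : ∀ i ω, |Y i ω| ≤ 1)
    {s : Finset ι} {V r : ℝ} (hV : ∑ i ∈ s, ∫ ω, Y i ω ^ 2 ∂P ≤ V) (hr : 0 ≤ r) (hrV : r ≤ V)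
    (κ : J → ι → σ) :
    P.real {ω | ∃ g : J → σ → ℂ, (∀ j k, ‖g j k‖ ≤ 1) ∧
        r < ‖correlationForm s (fun i => (Y i ω : ℂ)) κ g‖} ≤
      4 ^ (Fintype.card J * Fintype.card σ) *
        (4 * Real.exp (-(r ^ 2 / (16 * ((2 ^ Fintype.card J) ^ 2 * V))))) := by
  classical
  have := hindep.isProbabilityMeasure
  let G : Finset (J → σ → ℂ) := Fintype.piFinset fun _ => Fintype.piFinset fun _ => squareVertices
  have hmemG : ∀ g, g ∈ G ↔ ∀ j k, g j k ∈ squareVertices := fun g => by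
    simp only [G, Fintype.mem_piFinset]
  have hcardG : G.card ≤ 4 ^ (Fintype.card J * Fintype.card σ) := by
    simp only [G, Fintype.card_piFinset, Finset.prod_const, Finset.card_univ]
    rw [← pow_mul, mul_comm (Fintype.card σ)]
    exact Nat.pow_le_pow_left card_squareVertices_le _
  have hcover : {ω | ∃ g : J → σ → ℂ, (∀ j k, ‖g j k‖ ≤ 1) ∧
      r < ‖correlationForm s (fun i => (Y i ω : ℂ)) κ g‖} ⊆
      ⋃ g ∈ G, {ω | r < ‖correlationForm s (fun i => (Y i ω : ℂ)) κ g‖} := by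
    rintro ω ⟨g, hg, hlt⟩
    by_contra! hω
    simp only [Set.mem_iUnion, Set.mem_ofPred_eq, exists_prop, not_exists, not_and, not_lt] at hω
    exact hlt.not_ge (norm_correlationForm_le_of_vertices
      (fun g hg => hω g ((hmemG g).2 hg)) hg)
  have htail : ∀ g ∈ G, P.real {ω | r < ‖correlationForm s (fun i => (Y i ω : ℂ)) κ g‖} ≤
      4 * Real.exp (-(r ^ 2 / (16 * ((2 ^ Fintype.card J) ^ 2 * V)))) := fun g hg => by
    simp only [correlationForm_apply]
    refine measureReal_norm_sum_ofReal_mul_gt_le_exp hindep hY hmean hbound (by positivity)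
      (fun i => ?_) hV hr ?_
    · rw [norm_prod, ← Finset.card_univ, ← Finset.prod_const]
      exact Finset.prod_le_prod (fun _ _ => norm_nonneg _) fun j _ =>
        norm_le_two_of_mem_squareVertices ((hmemG g).1 hg j _)
    · have : (1 : ℝ) ≤ 2 ^ Fintype.card J := one_le_pow₀ one_le_two
      nlinarith
  calc _ ≤ ∑ g ∈ G, P.real {ω | r < ‖correlationForm s (fun i => (Y i ω : ℂ)) κ g‖} :=
        (measureReal_mono hcover (measure_ne_top _ _)).trans (measureReal_biUnion_finset_le _ _)
    _ ≤ G.card * (4 * Real.exp (-(r ^ 2 / (16 * ((2 ^ Fintype.card J) ^ 2 * V))))) := by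
        rw [← nsmul_eq_mul]
        exact Finset.sum_le_card_nsmul _ _ _ htail
    _ ≤ _ := by
        gcongr
        exact_mod_cast hcardG

end Vertices

section Digits

variable {ℓ q : ℕ}

/-- The starting point `∑ i, i * (q - d i) * q ^ i` attached to base `q` digits `d i`. The
progression with this start and step `∑ i, d i * q ^ i` has a `j`-th term in which `d j` cancels. -/
def separatingStart (d : Fin (ℓ + 1) → Fin q) : ℕ :=
  ∑ i : Fin (ℓ + 1), (i : ℕ) * (q - d i) * q ^ (i : ℕ)

/-- The `j`-th term of the progression that starts at `separatingStart d` and has step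
`∑ i, d i * q ^ i`, as a function of the digits `e` other than `d j`. -/
def separatedTerm (j : Fin (ℓ + 1)) (e : Fin ℓ → Fin q) : ℕ :=
  (j : ℕ) * q * q ^ (j : ℕ) +
    ∑ i, ((j.succAbove i : ℕ) * (q - e i) + (j : ℕ) * e i) * q ^ (j.succAbove i : ℕ)

lemma separatingStart_add_mul (d : Fin (ℓ + 1) → Fin q) (j : Fin (ℓ + 1)) :
    separatingStart d + (j : ℕ) * ∑ i, (d i : ℕ) * q ^ (i : ℕ) =
      separatedTerm j (j.removeNth d) := by
  have hcancel : (j : ℕ) * (q - d j) + j * d j = j * q := by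
    rw [← mul_add, Nat.sub_add_cancel (d j).isLt.le]
  rw [separatingStart, separatedTerm, Finset.mul_sum, ← Finset.sum_add_distrib,
    Fin.sum_univ_succAbove _ j, ← hcancel]
  simp only [Fin.removeNth]
  congr 1
  · ring
  · exact Finset.sum_congr rfl fun i _ => by ring

lemma exists_digits (hq : 0 < q) (k : ℕ) :
    ∃ d : ℕ → Fin k → Fin q, ∀ n < q ^ k, ∑ i, (d n i : ℕ) * q ^ (i : ℕ) = n := by
  refine ⟨fun n => finFunctionFinEquiv.symm ⟨n % q ^ k, Nat.mod_lt _ (by positivity)⟩,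
    fun n hn => ?_⟩
  rw [← finFunctionFinEquiv_apply, Equiv.apply_symm_apply]
  exact Nat.mod_eq_of_lt hn

/-- The weights `c n`, `n < N`, correlate by at most `B` with all products of functions bounded by
`1` along progressions of length `J` and step `n`, started at suitable points `h n` which do not
depend on the functions. -/
def HasShiftedProgressionBound (J : ℕ) (c : ℕ → ℝ) (N : ℕ) (B : ℝ) : Prop :=
  ∃ h : ℕ → ℕ, ∀ f : Fin J → ℕ → ℂ, (∀ j m, ‖f j m‖ ≤ 1) →
    ‖∑ n ∈ Finset.range N, (c n : ℂ) * ∏ j, f j (h n + (j : ℕ) * n)‖ ≤ B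

lemma hasShiftedProgressionBound_of_correlationForm_le {d : ℕ → Fin (ℓ + 1) → Fin q} {N : ℕ}
    (hd : ∀ n < N, ∑ i, (d n i : ℕ) * q ^ (i : ℕ) = n) {c : ℕ → ℝ} {B : ℝ}
    (hB : ∀ g : Fin (ℓ + 1) → (Fin ℓ → Fin q) → ℂ, (∀ j e, ‖g j e‖ ≤ 1) →
      ‖correlationForm (Finset.range N) (fun n => (c n : ℂ)) (fun j n => j.removeNth (d n)) g‖ ≤
        B) :
    HasShiftedProgressionBound (ℓ + 1) c N B := by
  refine ⟨fun n => separatingStart (d n), fun f hf => ?_⟩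
  have hterm : ∀ n ∈ Finset.range N, ∀ j : Fin (ℓ + 1),
      separatingStart (d n) + (j : ℕ) * n = separatedTerm j (j.removeNth (d n)) := fun n hn j => by
    rw [← separatingStart_add_mul, hd n (Finset.mem_range.1 hn)]
  refine le_of_eq_of_le ?_ (hB (fun j e => f j (separatedTerm j e)) fun j e => hf j _)
  rw [correlationForm_apply]
  exact congrArg norm (Finset.sum_congr rfl fun n hn => by simp only [hterm n hn])

end Digits

namespace IsRandomIndicator

variable {Ω : Type*} [MeasurableSpace Ω] {P : Measure Ω} {u : ℕ → ℝ} {U : ℕ → Ω → ℝ}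

lemma isProbabilityMeasure (hU : IsRandomIndicator P u U) : IsProbabilityMeasure P :=
  hU.indep.isProbabilityMeasure

lemma prob_nonneg (hU : IsRandomIndicator P u U) (n : ℕ) : 0 ≤ u n := by
  rw [← hU.law n]
  exact measureReal_nonneg

lemma prob_le_one (hU : IsRandomIndicator P u U) (n : ℕ) : u n ≤ 1 := by
  have := hU.isProbabilityMeasure
  rw [← hU.law n]
  exact measureReal_le_one

lemma sum_prob_le (hU : IsRandomIndicator P u U) (N : ℕ) : ∑ n ∈ Finset.range N, u n ≤ N := by
  simpa using Finset.sum_le_card_nsmul (Finset.range N) u 1 fun n _ => hU.prob_le_one n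

lemma nonneg (hU : IsRandomIndicator P u U) (n : ℕ) (ω : Ω) : 0 ≤ U n ω := by
  rcases hU.zero_or_one n ω with h | h <;> simp [h]

lemma abs_sub_le_one (hU : IsRandomIndicator P u U) (n : ℕ) (ω : Ω) : |U n ω - u n| ≤ 1 := by
  have hu₀ := hU.prob_nonneg n
  have hu₁ := hU.prob_le_one n
  rcases hU.zero_or_one n ω with h | h <;> rw [h, abs_le] <;> constructor <;> linarith

lemma integrable (hU : IsRandomIndicator P u U) (n : ℕ) : Integrable (U n) P := by
  have := hU.isProbabilityMeasure
  refine .of_bound (hU.measurable n).aestronglyMeasurable 1 (ae_of_all _ fun ω => ?_)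
  rcases hU.zero_or_one n ω with h | h <;> simp [h]

lemma integral_eq (hU : IsRandomIndicator P u U) (n : ℕ) : ∫ ω, U n ω ∂P = u n := by
  have hmeas : MeasurableSet {ω | U n ω = 1} := hU.measurable n (measurableSet_singleton 1)
  have hindicator : U n = {ω | U n ω = 1}.indicator 1 := by
    ext ω
    rcases hU.zero_or_one n ω with h | h <;> simp [Set.indicator, h]
  rw [← hU.law n, ← integral_indicator_one hmeas, ← hindicator]

lemma integral_sub_eq_zero (hU : IsRandomIndicator P u U) (n : ℕ) :
    ∫ ω, (U n ω - u n) ∂P = 0 := by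
  have := hU.isProbabilityMeasure
  rw [integral_sub (hU.integrable n) (integrable_const _), hU.integral_eq, integral_const,
    probReal_univ, one_smul, sub_self]

lemma integral_sub_sq_le (hU : IsRandomIndicator P u U) (n : ℕ) :
    ∫ ω, (U n ω - u n) ^ 2 ∂P ≤ u n := by
  have := hU.isProbabilityMeasure
  have hsq : ∀ ω, (U n ω - u n) ^ 2 = (1 - 2 * u n) * U n ω + u n ^ 2 := fun ω => by
    rcases hU.zero_or_one n ω with h | h <;> rw [h] <;> ring
  simp only [hsq]
  rw [integral_add ((hU.integrable n).const_mul _) (integrable_const _), integral_const_mul,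
    hU.integral_eq, integral_const, probReal_univ, one_smul]
  nlinarith [sq_nonneg (u n)]

/-- The digit separation leaves only `q ^ ℓ` values of each of the `ℓ + 1` functions to be
controlled, and the union bound is over their discretizations. -/
lemma measureReal_not_hasShiftedProgressionBound_le (hU : IsRandomIndicator P u U) {ℓ q N : ℕ}
    (hq : 0 < q) (hN : N ≤ q ^ (ℓ + 1)) {t : ℝ} (ht₀ : 0 ≤ t) (ht₁ : t ≤ 1) :
    P.real {ω | ¬ HasShiftedProgressionBound (ℓ + 1) (fun n => U n ω - u n) N
        (t * ∑ n ∈ Finset.range N, u n)} ≤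
      4 ^ ((ℓ + 1) * q ^ ℓ) * (4 * Real.exp
        (-(t ^ 2 * (∑ n ∈ Finset.range N, u n) / (16 * (2 ^ (ℓ + 1)) ^ 2)))) := by
  have := hU.isProbabilityMeasure
  obtain ⟨d, hd⟩ := exists_digits hq (ℓ + 1)
  set w := ∑ n ∈ Finset.range N, u n with hw
  have hw₀ : 0 ≤ w := Finset.sum_nonneg fun n _ => hU.prob_nonneg n
  have htail := measureReal_exists_correlationForm_gt_le (Y := fun n ω => U n ω - u n)
    (hU.indep.comp (fun n y => y - u n) fun n => by fun_prop)
    (fun n => (hU.measurable n).sub_const _) hU.integral_sub_eq_zero hU.abs_sub_le_one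
    (s := Finset.range N) (Finset.sum_le_sum fun n _ => hU.integral_sub_sq_le n)
    (mul_nonneg ht₀ hw₀) (mul_le_of_le_one_left hw₀ ht₁)
    fun (j : Fin (ℓ + 1)) n => j.removeNth (d n)
  have hexponent : (t * w) ^ 2 / (16 * ((2 ^ (ℓ + 1)) ^ 2 * w)) =
      t ^ 2 * w / (16 * (2 ^ (ℓ + 1)) ^ 2) := by
    rcases eq_or_ne w 0 with h | h
    · simp [h]
    · field_simp
  simp only [Fintype.card_fin, Fintype.card_fun, ← hw, hexponent] at htail
  refine (measureReal_mono (fun ω hω => ?_) (measure_ne_top _ _)).trans htail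
  contrapose! hω
  simp only [Set.mem_ofPred_eq, not_exists, not_and, not_lt, not_not] at hω ⊢
  exact hasShiftedProgressionBound_of_correlationForm_le (fun n hn => hd n (hn.trans_le hN)) hω

end IsRandomIndicator

section BorelCantelli

lemma exists_le_pow_succ_and_pow_le (ℓ : ℕ) {N : ℕ} (hN : 1 ≤ N) :
    ∃ q : ℕ, 0 < q ∧ N ≤ q ^ (ℓ + 1) ∧
      (q : ℝ) ^ ℓ ≤ 2 ^ ℓ * (N : ℝ) ^ ((ℓ : ℝ) / (ℓ + 1)) := by
  set y : ℝ := (N : ℝ) ^ ((1 : ℝ) / (ℓ + 1)) with hy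
  have hy₁ : 1 ≤ y := Real.one_le_rpow (by exact_mod_cast hN) (by positivity)
  have hpow_succ : y ^ (ℓ + 1) = N := by
    rw [hy, ← Real.rpow_natCast, ← Real.rpow_mul N.cast_nonneg, Nat.cast_add_one,
      one_div_mul_cancel (by positivity), Real.rpow_one]
  have hpow : y ^ ℓ = (N : ℝ) ^ ((ℓ : ℝ) / (ℓ + 1)) := by
    rw [hy, ← Real.rpow_natCast, ← Real.rpow_mul N.cast_nonneg, one_div_mul_eq_div]
  refine ⟨⌈y⌉₊, Nat.ceil_pos.2 (by linarith), ?_, ?_⟩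
  · have : (N : ℝ) ≤ (⌈y⌉₊ : ℝ) ^ (ℓ + 1) := hpow_succ ▸ by gcongr; exact Nat.le_ceil y
    exact_mod_cast this
  · rw [← hpow, ← mul_pow]
    gcongr
    linarith [Nat.ceil_lt_add_one (zero_le_one.trans hy₁)]

lemma four_pow_mul_four_mul_exp_neg_le {m N : ℕ} (hN : 1 ≤ N) {x : ℝ}
    (hx : Real.log 4 * m + 2 * Real.log N ≤ x) :
    (4 : ℝ) ^ m * (4 * Real.exp (-x)) ≤ 4 * (1 / (N : ℝ) ^ 2) := by
  have hN₀ : (0 : ℝ) < N := by exact_mod_cast hN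
  have hfour : (4 : ℝ) ^ m = Real.exp (Real.log 4 * m) := by
    rw [← Real.rpow_natCast, Real.rpow_def_of_pos four_pos]
  have hsq : 1 / (N : ℝ) ^ 2 = Real.exp (-(2 * Real.log N)) := by
    rw [Real.exp_neg, two_mul, Real.exp_add, Real.exp_log hN₀, one_div, sq]
  rw [hfour, hsq, mul_left_comm, ← Real.exp_add]
  gcongr
  linarith

lemma eventually_log_le_rpow {ℓ : ℕ} (hℓ : 1 ≤ ℓ) :
    ∀ᶠ N : ℕ in atTop, Real.log N ≤ (N : ℝ) ^ ((ℓ : ℝ) / (ℓ + 1)) := by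
  have hpos : (0 : ℝ) < (ℓ : ℝ) / (ℓ + 1) := by positivity
  filter_upwards [((isLittleO_log_rpow_atTop hpos).comp_tendsto
    tendsto_natCast_atTop_atTop).bound one_pos] with N hN
  rw [one_mul] at hN
  exact ((le_abs_self _).trans hN).trans_eq
    (Real.norm_of_nonneg (Real.rpow_nonneg N.cast_nonneg _))

variable {Ω : Type*} [MeasurableSpace Ω] {P : Measure Ω} {u : ℕ → ℝ} {U : ℕ → Ω → ℝ}

namespace IsRandomIndicator

lemma eventually_measureReal_not_hasShiftedProgressionBound_le (hU : IsRandomIndicator P u U)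
    {ℓ : ℕ} (hℓ : 1 ≤ ℓ) {ε : ℕ → ℝ} (hε₀ : ∀ N, 0 ≤ ε N) (hε₁ : ∀ᶠ N in atTop, ε N ≤ 1)
    (hrate : Tendsto (fun N : ℕ => ε N ^ 2 * (∑ n ∈ Finset.range N, u n) /
      (N : ℝ) ^ ((ℓ : ℝ) / (ℓ + 1))) atTop atTop) :
    ∀ᶠ N in atTop, P.real {ω | ¬ HasShiftedProgressionBound (ℓ + 1) (fun n => U n ω - u n) N
      (ε N * ∑ n ∈ Finset.range N, u n)} ≤ 4 * (1 / (N : ℝ) ^ 2) := by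
  filter_upwards [hrate.eventually_ge_atTop
      ((Real.log 4 * ((ℓ + 1) * 2 ^ ℓ) + 2) * (16 * (2 ^ (ℓ + 1)) ^ 2)),
    hε₁, eventually_log_le_rpow hℓ, eventually_ge_atTop 1] with N hrateN hεN hlog hN
  obtain ⟨q, hq, hNq, hqN⟩ := exists_le_pow_succ_and_pow_le ℓ hN
  refine (hU.measureReal_not_hasShiftedProgressionBound_le hq hNq (hε₀ N) hεN).trans
    (four_pow_mul_four_mul_exp_neg_le hN ?_)
  have hy : 0 < (N : ℝ) ^ ((ℓ : ℝ) / (ℓ + 1)) :=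
    Real.rpow_pos_of_pos (by exact_mod_cast hN) _
  rw [le_div_iff₀ hy] at hrateN
  rw [le_div_iff₀ (by positivity)]
  refine le_trans ?_ hrateN
  rw [mul_right_comm]
  gcongr
  push_cast
  calc Real.log 4 * ((ℓ + 1) * q ^ ℓ) + 2 * Real.log N
      ≤ Real.log 4 * ((ℓ + 1) * (2 ^ ℓ * (N : ℝ) ^ ((ℓ : ℝ) / (ℓ + 1)))) +
        2 * (N : ℝ) ^ ((ℓ : ℝ) / (ℓ + 1)) := by gcongr
    _ = (Real.log 4 * ((ℓ + 1) * 2 ^ ℓ) + 2) * (N : ℝ) ^ ((ℓ : ℝ) / (ℓ + 1)) := by ring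

theorem ae_eventually_hasShiftedProgressionBound (hU : IsRandomIndicator P u U)
    {ℓ : ℕ} (hℓ : 1 ≤ ℓ) {ε : ℕ → ℝ} (hε₀ : ∀ N, 0 ≤ ε N) (hε₁ : ∀ᶠ N in atTop, ε N ≤ 1)
    (hrate : Tendsto (fun N : ℕ => ε N ^ 2 * (∑ n ∈ Finset.range N, u n) /
      (N : ℝ) ^ ((ℓ : ℝ) / (ℓ + 1))) atTop atTop) :
    ∀ᵐ ω ∂P, ∀ᶠ N in atTop, HasShiftedProgressionBound (ℓ + 1) (fun n => U n ω - u n) N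
      (ε N * ∑ n ∈ Finset.range N, u n) := by
  have := hU.isProbabilityMeasure
  have hsummable : Summable fun N => P.real {ω | ¬ HasShiftedProgressionBound (ℓ + 1)
      (fun n => U n ω - u n) N (ε N * ∑ n ∈ Finset.range N, u n)} := by
    refine .of_norm_bounded_eventually_nat
      ((Real.summable_one_div_nat_pow.2 one_lt_two).mul_left 4) ?_
    filter_upwards [hU.eventually_measureReal_not_hasShiftedProgressionBound_le hℓ hε₀ hε₁ hrate]
      with N hN
    rwa [Real.norm_of_nonneg measureReal_nonneg]
  have htsum := hsummable.tsum_ofReal_ne_top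
  simp only [ofReal_measureReal (measure_ne_top P _)] at htsum
  filter_upwards [ae_eventually_notMem htsum] with ω hω
  simpa only [Set.mem_ofPred_eq, not_not] using hω

end IsRandomIndicator

end BorelCantelli

section Dynamics

/-- The numerator `∑_{n<N} c n · T^n F₁(x) · T^{2n} F₂(x) ⋯ T^{ℓn} F_ℓ(x)` of an average of multiple
products with weights `c`. -/
noncomputable def weightedSum {X : Type*} (T : X → X) {ℓ : ℕ} (F : Fin ℓ → X → ℂ) (c : ℕ → ℝ)
    (N : ℕ) (x : X) : ℂ :=
  ∑ n ∈ Finset.range N, c n • multipleProduct T F n x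

lemma norm_prod_le_one {ι : Type*} (s : Finset ι) {f : ι → ℂ} (hf : ∀ i ∈ s, ‖f i‖ ≤ 1) :
    ‖∏ i ∈ s, f i‖ ≤ 1 := by
  rw [norm_prod]
  exact Finset.prod_le_one (fun _ _ => norm_nonneg _) hf

section Pointwise

variable {X : Type*} {T : X → X} {ℓ : ℕ} {F : Fin ℓ → X → ℂ} {c : ℕ → ℝ}

lemma differenceAverage_eq_smul_weightedSum (a u : ℕ → ℝ) (N : ℕ) (x : X) :
    differenceAverage T F a u N x =
      (∑ n ∈ Finset.range N, a n)⁻¹ • weightedSum T F (fun n => a n - u n) N x :=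
  rfl

lemma differenceAverage_mul (C : Fin ℓ → ℂ) (a u : ℕ → ℝ) (N : ℕ) (x : X) :
    differenceAverage T (fun j y => C j * F j y) a u N x =
      (∏ j, C j) * differenceAverage T F a u N x := by
  simp only [differenceAverage, multipleProduct, Finset.prod_mul_distrib, Finset.mul_sum,
    Complex.real_smul]
  exact Finset.sum_congr rfl fun n _ => by ring

lemma norm_weightedSum_sub_le (hF : ∀ j x, ‖F j x‖ ≤ 1) {v : ℕ → ℝ} (hcv : ∀ n, |c n| ≤ v n)
    {N M : ℕ} (hNM : N ≤ M) (x : X) :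
    ‖weightedSum T F c M x - weightedSum T F c N x‖ ≤
      ∑ n ∈ Finset.range M, v n - ∑ n ∈ Finset.range N, v n := by
  rw [weightedSum, weightedSum, ← Finset.sum_Ico_eq_sub _ hNM, ← Finset.sum_Ico_eq_sub _ hNM]
  refine norm_sum_le_of_le _ fun n _ => ?_
  rw [norm_smul, Real.norm_eq_abs]
  exact (mul_le_of_le_one_right (abs_nonneg _) (norm_prod_le_one _ fun j _ => hF j _)).trans
    (hcv n)

lemma norm_weightedSum_le (hF : ∀ j x, ‖F j x‖ ≤ 1) {v : ℕ → ℝ} (hcv : ∀ n, |c n| ≤ v n)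
    (N : ℕ) (x : X) : ‖weightedSum T F c N x‖ ≤ ∑ n ∈ Finset.range N, v n := by
  simpa [weightedSum] using norm_weightedSum_sub_le (T := T) hF hcv N.zero_le x

end Pointwise

variable {X : Type*} [MeasurableSpace X] {μ : Measure X} {T : X → X}

lemma measurable_weightedSum (hT : Measurable T) {ℓ : ℕ} {F : Fin ℓ → X → ℂ}
    (hF : ∀ j, Measurable (F j)) (c : ℕ → ℝ) (N : ℕ) : Measurable (weightedSum T F c N) :=
  Finset.measurable_sum _ fun n _ =>
    (Finset.measurable_prod _ fun j _ => (hF j).comp (hT.iterate _)).const_smul (c n)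

variable [IsFiniteMeasure μ]

/-- By invariance of `μ`, shifting the `n`-th term by `T^[h n]` does not change its integral. -/
lemma HasShiftedProgressionBound.norm_integral_sum_mul_prod_iterate_le {J N : ℕ} {c : ℕ → ℝ}
    {B : ℝ} (hB : HasShiftedProgressionBound J c N B) (hT : MeasurePreserving T μ μ)
    {F : Fin J → X → ℂ} (hF : ∀ j, Measurable (F j)) (hF₁ : ∀ j x, ‖F j x‖ ≤ 1) :
    ‖∫ x, ∑ n ∈ Finset.range N, (c n : ℂ) * ∏ j, F j (T^[(j : ℕ) * n] x) ∂μ‖ ≤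
      B * μ.real Set.univ := by
  obtain ⟨h, hh⟩ := hB
  have hmeas : ∀ k : Fin J → ℕ, Measurable fun x => ∏ j, F j (T^[k j] x) := fun k =>
    Finset.measurable_prod _ fun j _ => (hF j).comp (hT.measurable.iterate _)
  have hint : ∀ k : Fin J → ℕ, Integrable (fun x => ∏ j, F j (T^[k j] x)) μ := fun k =>
    .of_bound (hmeas k).aestronglyMeasurable 1
      (ae_of_all _ fun x => norm_prod_le_one _ fun j _ => hF₁ j _)
  have hshift : ∀ n, ∫ x, ∏ j, F j (T^[(j : ℕ) * n] x) ∂μ =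
      ∫ x, ∏ j, F j (T^[h n + (j : ℕ) * n] x) ∂μ := fun n => by
    have hTn := hT.iterate (h n)
    conv_lhs => rw [← hTn.map_eq]
    rw [integral_map hTn.measurable.aemeasurable (hmeas _).aestronglyMeasurable]
    simp only [← Function.iterate_add_apply, add_comm]
  rw [integral_finsetSum _ fun n _ => (hint _).const_mul _]
  simp only [integral_const_mul, hshift]
  simp only [← integral_const_mul]
  rw [← integral_finsetSum _ fun n _ => (hint _).const_mul _]
  exact norm_integral_le_of_norm_le_const
    (ae_of_all _ fun x => hh (fun j m => F j (T^[m] x)) fun j m => hF₁ j _)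

lemma HasShiftedProgressionBound.norm_integral_mul_weightedSum_le {ℓ N : ℕ} {c : ℕ → ℝ} {B : ℝ}
    (hB : HasShiftedProgressionBound (ℓ + 1) c N B) (hT : MeasurePreserving T μ μ)
    {F : Fin ℓ → X → ℂ} (hF : ∀ j, Measurable (F j)) (hF₁ : ∀ j x, ‖F j x‖ ≤ 1)
    {F₀ : X → ℂ} (hF₀ : Measurable F₀) (hF₀₁ : ∀ x, ‖F₀ x‖ ≤ 1) :
    ‖∫ x, F₀ x * weightedSum T F c N x ∂μ‖ ≤ B * μ.real Set.univ := by
  have hbound := hB.norm_integral_sum_mul_prod_iterate_le hT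
    (F := (Fin.cons F₀ F : Fin (ℓ + 1) → X → ℂ))
    (Fin.cases hF₀ hF) (Fin.cases hF₀₁ hF₁)
  refine le_of_eq_of_le (congrArg norm (integral_congr_ae (ae_of_all _ fun x => ?_))) hbound
  simp only [weightedSum, multipleProduct, Finset.mul_sum, Fin.prod_univ_succ, Fin.cons_zero,
    Fin.cons_succ, Fin.val_zero, zero_mul, Function.iterate_zero, id, Fin.val_succ,
    Complex.real_smul]
  exact Finset.sum_congr rfl fun n _ => mul_left_comm _ _ _

lemma HasShiftedProgressionBound.integral_norm_weightedSum_sq_le {ℓ N : ℕ} {c : ℕ → ℝ} {B : ℝ}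
    (hB : HasShiftedProgressionBound (ℓ + 1) c N B) (hT : MeasurePreserving T μ μ)
    {F : Fin ℓ → X → ℂ} (hF : ∀ j, Measurable (F j)) (hF₁ : ∀ j x, ‖F j x‖ ≤ 1)
    {v : ℕ → ℝ} (hcv : ∀ n, |c n| ≤ v n) {K : ℝ} (hK : 0 < K)
    (hvK : ∑ n ∈ Finset.range N, v n ≤ K) :
    ∫ x, ‖weightedSum T F c N x‖ ^ 2 ∂μ ≤ K * (B * μ.real Set.univ) := by
  set D := weightedSum T F c N
  have hD : Measurable D := measurable_weightedSum hT.measurable hF c N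
  have hconj : ∀ x, ‖(K : ℂ)⁻¹ * (starRingEnd ℂ) (D x)‖ ≤ 1 := fun x => by
    rw [norm_mul, norm_inv, RCLike.norm_conj, Complex.norm_real, Real.norm_of_nonneg hK.le,
      inv_mul_le_one₀ hK]
    exact (norm_weightedSum_le hF₁ hcv N x).trans hvK
  have hbound := hB.norm_integral_mul_weightedSum_le hT hF hF₁
    ((Complex.continuous_conj.measurable.comp hD).const_mul _) hconj
  have hsq : ∀ x, (K : ℂ)⁻¹ * (starRingEnd ℂ) (D x) * D x = ((K⁻¹ * ‖D x‖ ^ 2 : ℝ) : ℂ) :=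
    fun x => by
      rw [mul_assoc, Complex.conj_mul']
      push_cast
      rfl
  simp only [Function.comp_apply] at hbound
  rw [integral_congr_ae (ae_of_all _ hsq), integral_complex_ofReal, Complex.norm_real,
    integral_const_mul] at hbound
  exact (inv_mul_le_iff₀ hK).1 ((Real.le_norm_self _).trans hbound)

end Dynamics

section FirstPassage

/-- The first index at which `w` reaches the level `R`; it is `0` if `w` never does. -/
noncomputable def firstPassage (w : ℕ → ℝ) (R : ℝ) : ℕ :=
  sInf {N | R ≤ w N}

variable {w : ℕ → ℝ}

lemma firstPassage_le {R : ℝ} {N : ℕ} (hN : R ≤ w N) : firstPassage w R ≤ N :=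
  Nat.sInf_le hN

lemma le_apply_firstPassage (hw : Tendsto w atTop atTop) (R : ℝ) : R ≤ w (firstPassage w R) :=
  Nat.sInf_mem (hw.eventually_ge_atTop R).exists

lemma tendsto_firstPassage (hw : Tendsto w atTop atTop) :
    Tendsto (firstPassage w) atTop atTop := by
  refine tendsto_atTop.2 fun m => ?_
  filter_upwards [(eventually_all_finset (Finset.range m)).2 fun n _ => eventually_gt_atTop (w n)]
    with R hR
  by_contra! hlt
  exact (hR _ (Finset.mem_range.2 hlt)).not_ge (le_apply_firstPassage hw R)

lemma tendsto_firstPassage_pow (hw : Tendsto w atTop atTop) {b : ℝ} (hb : 1 < b) :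
    Tendsto (fun k : ℕ => firstPassage w (b ^ k)) atTop atTop :=
  (tendsto_firstPassage hw).comp (tendsto_pow_atTop_atTop_of_one_lt hb)

variable {E : Type*} [SeminormedAddCommGroup E] {D : ℕ → E} {V : ℕ → ℝ} {L : ℝ}

lemma eventually_norm_le_of_firstPassage (hw : Tendsto w atTop atTop) (hw_mono : Monotone w)
    (hD : ∀ ⦃N M⦄, N ≤ M → ‖D M - D N‖ ≤ V M - V N) {b η : ℝ} (hb : 1 < b) (hη : 0 ≤ η)
    (hV : ∀ᶠ N in atTop, |V N - L * w N| ≤ η * w N)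
    (hDb : ∀ᶠ k : ℕ in atTop,
      ‖D (firstPassage w (b ^ k))‖ ≤ η * w (firstPassage w (b ^ k))) :
    ∀ᶠ N in atTop, ‖D N‖ ≤ (|L| * (b - 1) + 3 * η) * w N := by
  obtain ⟨K, hK⟩ := eventually_atTop.1
    (hDb.and ((tendsto_firstPassage_pow hw hb).eventually hV))
  filter_upwards [hV, hw.eventually_ge_atTop (b ^ K)] with N hVN hN
  obtain ⟨k, hk, hk_succ⟩ := exists_nat_pow_near ((one_le_pow₀ hb.le).trans hN) hb
  have hKk : K ≤ k := Nat.lt_succ_iff.1 ((pow_lt_pow_iff_right₀ hb).1 (hN.trans_lt hk_succ))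
  obtain ⟨hDc, hVc⟩ := hK k hKk
  set c := firstPassage w (b ^ k)
  have hcN : c ≤ N := firstPassage_le hk
  have hwc : b ^ k ≤ w c := le_apply_firstPassage hw _
  have hwcN : w c ≤ w N := hw_mono hcN
  have hjump : w N - w c ≤ (b - 1) * w N := by
    have : w N ≤ b * w c := hk_succ.le.trans (by rw [pow_succ']; gcongr)
    nlinarith
  have hincrement : V N - V c ≤ |L| * ((b - 1) * w N) + η * w N + η * w c := by
    have hL : L * (w N - w c) ≤ |L| * ((b - 1) * w N) :=
      mul_le_mul (le_abs_self L) hjump (sub_nonneg.2 hwcN) (abs_nonneg L)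
    linarith [le_of_abs_le hVN, neg_le_of_abs_le hVc]
  calc ‖D N‖ ≤ ‖D c‖ + ‖D N - D c‖ := norm_le_norm_add_norm_sub' _ _
    _ ≤ η * w c + (|L| * ((b - 1) * w N) + η * w N + η * w c) := by
      gcongr
      exact (hD hcN).trans hincrement
    _ ≤ η * w N + (|L| * ((b - 1) * w N) + η * w N + η * w N) := by gcongr
    _ = (|L| * (b - 1) + 3 * η) * w N := by ring

/-- The increments of `D` between the times at which `w` passes `b ^ k` and `b ^ (k + 1)` are
`O((b - 1) * w)`, so convergence along these times for bases `b` close to `1` suffices. -/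
lemma tendsto_norm_div_zero_of_firstPassage (hw : Tendsto w atTop atTop) (hw_mono : Monotone w)
    (hD : ∀ ⦃N M⦄, N ≤ M → ‖D M - D N‖ ≤ V M - V N)
    (hV : Tendsto (fun N => V N / w N) atTop (𝓝 L))
    {b : ℕ → ℝ} (hb : ∀ r, 1 < b r) (hb_lim : Tendsto b atTop (𝓝 1))
    (hDb : ∀ r, Tendsto (fun k : ℕ =>
      ‖D (firstPassage w (b r ^ k))‖ / w (firstPassage w (b r ^ k))) atTop (𝓝 0)) :
    Tendsto (fun N => ‖D N‖ / w N) atTop (𝓝 0) := by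
  have hw_pos : ∀ᶠ N in atTop, 0 < w N := hw.eventually_gt_atTop 0
  refine Metric.tendsto_nhds.2 fun ε hε => ?_
  have hη : 0 < ε / 8 := by positivity
  have hjump : Tendsto (fun r => |L| * (b r - 1)) atTop (𝓝 0) := by
    simpa using (hb_lim.sub_const 1).const_mul |L|
  obtain ⟨r, hr⟩ := (hjump.eventually_le_const hη).exists
  have hVη : ∀ᶠ N in atTop, |V N - L * w N| ≤ ε / 8 * w N := by
    filter_upwards [hV.eventually (Metric.closedBall_mem_nhds L hη), hw_pos] with N hN hwN
    rwa [Real.dist_eq, div_sub' hwN.ne', abs_div, abs_of_pos hwN, div_le_iff₀ hwN,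
      mul_comm (w N)] at hN
  have hDη : ∀ᶠ k : ℕ in atTop,
      ‖D (firstPassage w (b r ^ k))‖ ≤ ε / 8 * w (firstPassage w (b r ^ k)) := by
    filter_upwards [(hDb r).eventually_le_const hη,
      (tendsto_firstPassage_pow hw (hb r)).eventually hw_pos] with k hk hwk
    exact (div_le_iff₀ hwk).1 hk
  filter_upwards [eventually_norm_le_of_firstPassage hw hw_mono hD (hb r) hη.le hVη hDη, hw_pos]
    with N hN hwN
  rw [Real.dist_0_eq_abs, abs_of_nonneg (by positivity), div_lt_iff₀ hwN]
  nlinarith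

end FirstPassage

section DeterministicTheorem

lemma ae_tendsto_zero_of_summable_integral_norm {X E : Type*} [MeasurableSpace X] {μ : Measure X}
    [NormedAddCommGroup E] {f : ℕ → X → E} (hf : ∀ k, Integrable (f k) μ)
    (hsum : Summable fun k => ∫ x, ‖f k x‖ ∂μ) :
    ∀ᵐ x ∂μ, Tendsto (fun k => f k x) atTop (𝓝 0) := by
  have htsum : ∑' k, eLpNorm (f k) 1 μ ≠ ⊤ := by
    simp only [eLpNorm_one_eq_lintegral_enorm, ← ofReal_integral_norm_eq_lintegral_enorm (hf _)]
    exact hsum.tsum_ofReal_ne_top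
  filter_upwards [summable_norm_of_tsum_eLpNorm_ne_top le_rfl
    (fun k => (hf k).aestronglyMeasurable) htsum] with x hx
  exact tendsto_zero_iff_norm_tendsto_zero.2 hx.tendsto_atTop_zero

lemma HasShiftedProgressionBound.abs_sum_le {J N : ℕ} {c : ℕ → ℝ} {B : ℝ}
    (hB : HasShiftedProgressionBound J c N B) : |∑ n ∈ Finset.range N, c n| ≤ B := by
  obtain ⟨_, hh⟩ := hB
  have hone := hh (fun _ _ => 1) fun _ _ => norm_one.le
  simpa only [Finset.prod_const_one, mul_one, ← Complex.ofReal_sum, Complex.norm_real,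
    Real.norm_eq_abs] using hone

variable {a u ε : ℕ → ℝ}

lemma tendsto_sum_div_sum_of_hasShiftedProgressionBound {J : ℕ}
    (hw : Tendsto (fun N => ∑ n ∈ Finset.range N, u n) atTop atTop)
    (hε : Tendsto ε atTop (𝓝 0))
    (hB : ∀ᶠ N in atTop, HasShiftedProgressionBound J (fun n => a n - u n) N
      (ε N * ∑ n ∈ Finset.range N, u n)) :
    Tendsto (fun N => (∑ n ∈ Finset.range N, a n) / ∑ n ∈ Finset.range N, u n)
      atTop (𝓝 1) := by
  refine tendsto_iff_norm_sub_tendsto_zero.2 (squeeze_zero' (.of_forall fun _ => norm_nonneg _)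
    ?_ hε)
  filter_upwards [hB, hw.eventually_gt_atTop 0] with N hN hwN
  rw [div_sub_one hwN.ne', Real.norm_eq_abs, abs_div, abs_of_pos hwN, div_le_iff₀ hwN,
    ← Finset.sum_sub_distrib]
  exact hN.abs_sum_le

lemma abs_sub_le_add (ha : ∀ n, 0 ≤ a n) (hu : ∀ n, 0 ≤ u n) (n : ℕ) :
    |a n - u n| ≤ a n + u n :=
  (abs_sub _ _).trans_eq (by rw [abs_of_nonneg (ha n), abs_of_nonneg (hu n)])

lemma tendsto_sum_add_div_sum {J : ℕ}
    (hw : Tendsto (fun N => ∑ n ∈ Finset.range N, u n) atTop atTop)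
    (hε : Tendsto ε atTop (𝓝 0))
    (hB : ∀ᶠ N in atTop, HasShiftedProgressionBound J (fun n => a n - u n) N
      (ε N * ∑ n ∈ Finset.range N, u n)) :
    Tendsto (fun N => (∑ n ∈ Finset.range N, (a n + u n)) / ∑ n ∈ Finset.range N, u n)
      atTop (𝓝 2) := by
  have hlim := (tendsto_sum_div_sum_of_hasShiftedProgressionBound hw hε hB).add_const 1
  rw [one_add_one_eq_two] at hlim
  refine hlim.congr' ?_
  filter_upwards [hw.eventually_ne_atTop 0] with N hN
  rw [Finset.sum_add_distrib, add_div, div_self hN]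

variable {ℓ : ℕ} {X : Type*} [MeasurableSpace X] {μ : Measure X} [IsFiniteMeasure μ] {T : X → X}
  {F : Fin ℓ → X → ℂ}

lemma eventually_integral_norm_weightedSum_div_sq_le (ha : ∀ n, 0 ≤ a n) (hu : ∀ n, 0 ≤ u n)
    (hw : Tendsto (fun N => ∑ n ∈ Finset.range N, u n) atTop atTop)
    (hε : Tendsto ε atTop (𝓝 0))
    (hB : ∀ᶠ N in atTop, HasShiftedProgressionBound (ℓ + 1) (fun n => a n - u n) N
      (ε N * ∑ n ∈ Finset.range N, u n))
    (hT : MeasurePreserving T μ μ) (hF : ∀ j, Measurable (F j)) (hF₁ : ∀ j x, ‖F j x‖ ≤ 1) :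
    ∀ᶠ N in atTop, ∫ x, (‖weightedSum T F (fun n => a n - u n) N x‖ /
      ∑ n ∈ Finset.range N, u n) ^ 2 ∂μ ≤ 3 * (ε N * μ.real Set.univ) := by
  filter_upwards [hB, hw.eventually_gt_atTop 0,
    (tendsto_sum_add_div_sum hw hε hB).eventually_le_const (by norm_num : (2 : ℝ) < 3)]
    with N hN hwN hVN
  simp only [div_pow]
  rw [integral_div, div_le_iff₀ (by positivity)]
  refine (hN.integral_norm_weightedSum_sq_le hT hF hF₁ (abs_sub_le_add ha hu)
    (by positivity) ((div_le_iff₀ hwN).1 hVN)).trans_eq ?_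
  ring

lemma ae_tendsto_norm_weightedSum_div_of_summable (ha : ∀ n, 0 ≤ a n) (hu : ∀ n, 0 ≤ u n)
    (hw : Tendsto (fun N => ∑ n ∈ Finset.range N, u n) atTop atTop)
    (hε : Tendsto ε atTop (𝓝 0))
    (hB : ∀ᶠ N in atTop, HasShiftedProgressionBound (ℓ + 1) (fun n => a n - u n) N
      (ε N * ∑ n ∈ Finset.range N, u n))
    (hT : MeasurePreserving T μ μ) (hF : ∀ j, Measurable (F j)) (hF₁ : ∀ j x, ‖F j x‖ ≤ 1)
    {c : ℕ → ℕ} (hc : Tendsto c atTop atTop) (hεc : Summable fun k => ε (c k)) :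
    ∀ᵐ x ∂μ, Tendsto (fun k => ‖weightedSum T F (fun n => a n - u n) (c k) x‖ /
      ∑ n ∈ Finset.range (c k), u n) atTop (𝓝 0) := by
  set D := weightedSum T F fun n => a n - u n
  set w : ℕ → ℝ := fun N => ∑ n ∈ Finset.range N, u n
  have hint : ∀ k, Integrable (fun x => (‖D (c k) x‖ / w (c k)) ^ 2) μ := fun k =>
    .of_bound
      (((measurable_weightedSum hT.measurable hF _ _).norm.div_const _).pow_const
        2).aestronglyMeasurable
      (((∑ n ∈ Finset.range (c k), (a n + u n)) / |w (c k)|) ^ 2) (ae_of_all _ fun x => by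
        rw [norm_pow, norm_div, norm_norm, Real.norm_eq_abs]
        gcongr
        exact norm_weightedSum_le hF₁ (abs_sub_le_add ha hu) _ _)
  have hsum : Summable fun k => ∫ x, ‖(‖D (c k) x‖ / w (c k)) ^ 2‖ ∂μ := by
    refine .of_norm_bounded_eventually_nat ((hεc.mul_right (μ.real Set.univ)).mul_left 3) ?_
    filter_upwards [hc.eventually
      (eventually_integral_norm_weightedSum_div_sq_le ha hu hw hε hB hT hF hF₁)] with k hk
    simp only [norm_pow, Real.norm_eq_abs, sq_abs]
    rwa [abs_of_nonneg (integral_nonneg fun x => sq_nonneg _)]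
  filter_upwards [ae_tendsto_zero_of_summable_integral_norm hint hsum] with x hx
  refine (tendsto_zero_iff_abs_tendsto_zero _).2 ?_
  simpa only [Function.comp_def, Real.sqrt_zero, Real.sqrt_sq_eq_abs] using hx.sqrt

lemma ae_tendsto_differenceAverage_of_norm_le_one (ha : ∀ n, 0 ≤ a n) (hu : ∀ n, 0 ≤ u n)
    (hw : Tendsto (fun N => ∑ n ∈ Finset.range N, u n) atTop atTop)
    (hε : Tendsto ε atTop (𝓝 0))
    (hε_sum : ∀ b : ℝ, 1 < b →
      Summable fun k : ℕ => ε (firstPassage (fun N => ∑ n ∈ Finset.range N, u n) (b ^ k)))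
    (hB : ∀ᶠ N in atTop, HasShiftedProgressionBound (ℓ + 1) (fun n => a n - u n) N
      (ε N * ∑ n ∈ Finset.range N, u n))
    (hT : MeasurePreserving T μ μ) (hF : ∀ j, Measurable (F j)) (hF₁ : ∀ j x, ‖F j x‖ ≤ 1) :
    ∀ᵐ x ∂μ, Tendsto (fun N => differenceAverage T F a u N x) atTop (𝓝 0) := by
  let b : ℕ → ℝ := fun r => 1 + 1 / ((r : ℝ) + 1)
  have hb : ∀ r, 1 < b r := fun r => lt_add_of_pos_right _ (by positivity)
  have hb_lim : Tendsto b atTop (𝓝 1) := by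
    simpa only [add_zero] using tendsto_one_div_add_atTop_nhds_zero_nat.const_add (1 : ℝ)
  have hw_mono : Monotone fun N => ∑ n ∈ Finset.range N, u n :=
    fun N M hNM => Finset.sum_le_sum_of_subset_of_nonneg (Finset.range_mono hNM) fun n _ _ => hu n
  filter_upwards [ae_all_iff.2 fun r => ae_tendsto_norm_weightedSum_div_of_summable ha hu hw hε hB
    hT hF hF₁ (tendsto_firstPassage_pow hw (hb r)) (hε_sum _ (hb r))] with x hx
  have hlim := tendsto_norm_div_zero_of_firstPassage hw hw_mono
    (fun N M hNM => norm_weightedSum_sub_le hF₁ (abs_sub_le_add ha hu) hNM x)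
    (tendsto_sum_add_div_sum hw hε hB) hb hb_lim hx
  have hquot := hlim.div (tendsto_sum_div_sum_of_hasShiftedProgressionBound hw hε hB) one_ne_zero
  rw [zero_div] at hquot
  refine tendsto_zero_iff_norm_tendsto_zero.2 (hquot.congr' ?_)
  filter_upwards [hw.eventually_ne_atTop 0] with N hN
  rw [Pi.div_apply, div_div_div_cancel_right₀ hN, differenceAverage_eq_smul_weightedSum,
    norm_smul, norm_inv, Real.norm_of_nonneg (Finset.sum_nonneg fun n _ => ha n), div_eq_inv_mul]

theorem ae_tendsto_differenceAverage (ha : ∀ n, 0 ≤ a n) (hu : ∀ n, 0 ≤ u n)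
    (hw : Tendsto (fun N => ∑ n ∈ Finset.range N, u n) atTop atTop)
    (hε : Tendsto ε atTop (𝓝 0))
    (hε_sum : ∀ b : ℝ, 1 < b →
      Summable fun k : ℕ => ε (firstPassage (fun N => ∑ n ∈ Finset.range N, u n) (b ^ k)))
    (hB : ∀ᶠ N in atTop, HasShiftedProgressionBound (ℓ + 1) (fun n => a n - u n) N
      (ε N * ∑ n ∈ Finset.range N, u n))
    (hT : MeasurePreserving T μ μ) (hF : ∀ j, Measurable (F j))
    (hF_bdd : ∀ j, ∃ C : ℝ, ∀ x, ‖F j x‖ ≤ C) :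
    ∀ᵐ x ∂μ, Tendsto (fun N => differenceAverage T F a u N x) atTop (𝓝 0) := by
  choose C hC using hF_bdd
  let K : Fin ℓ → ℝ := fun j => max (C j) 1
  have hK : ∀ j, 0 < K j := fun j => lt_max_of_lt_right one_pos
  have hnormalized : ∀ j x, ‖(K j : ℂ)⁻¹ * F j x‖ ≤ 1 := fun j x => by
    rw [norm_mul, norm_inv, Complex.norm_real, Real.norm_of_nonneg (hK j).le,
      inv_mul_le_one₀ (hK j)]
    exact (hC j x).trans (le_max_left _ _)
  filter_upwards [ae_tendsto_differenceAverage_of_norm_le_one ha hu hw hε hε_sum hB hT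
    (fun j => (hF j).const_mul _) hnormalized] with x hx
  have hscaled := hx.const_mul (∏ j, (K j : ℂ))
  simpa only [← differenceAverage_mul, mul_zero, mul_inv_cancel_left₀
    (Complex.ofReal_ne_zero.2 (hK _).ne')] using hscaled

end DeterministicTheorem

section Rate

/-- The relative error `(log N) ^ (-(1 + δ / 2))` allowed at time `N`. The exponent makes it
summable along geometric sequences of times. -/
noncomputable def logRate (δ : ℝ) (N : ℕ) : ℝ :=
  Real.log N ^ (-(1 + δ / 2))

variable {δ : ℝ}

lemma tendsto_log_natCast_atTop : Tendsto (fun N : ℕ => Real.log N) atTop atTop :=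
  Real.tendsto_log_atTop.comp tendsto_natCast_atTop_atTop

lemma logRate_nonneg (δ : ℝ) (N : ℕ) : 0 ≤ logRate δ N :=
  Real.rpow_nonneg (Real.log_natCast_nonneg N) _

lemma tendsto_logRate (hδ : 0 < δ) : Tendsto (logRate δ) atTop (𝓝 0) :=
  (tendsto_rpow_neg_atTop (by positivity)).comp tendsto_log_natCast_atTop

lemma logRate_sq (δ : ℝ) (N : ℕ) : logRate δ N ^ 2 = (Real.log N ^ (2 + δ))⁻¹ := by
  rw [logRate, ← Real.rpow_mul_natCast (Real.log_natCast_nonneg N),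
    ← Real.rpow_neg (Real.log_natCast_nonneg N)]
  congr 1
  push_cast
  ring

lemma summable_logRate_of_pow_le (hδ : 0 < δ) {b : ℝ} (hb : 1 < b) {c : ℕ → ℕ}
    (hc : ∀ k, b ^ k ≤ c k) : Summable fun k => logRate δ (c k) := by
  refine .of_norm_bounded_eventually_nat ((Real.summable_nat_rpow.2
    (by linarith : -(1 + δ / 2) < -1)).mul_left (Real.log b ^ (-(1 + δ / 2)))) ?_
  filter_upwards [eventually_gt_atTop 0] with k hk
  have hk₀ : (0 : ℝ) < k := by exact_mod_cast hk
  have hlogb := Real.log_pos hb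
  rw [Real.norm_of_nonneg (logRate_nonneg _ _), ← Real.mul_rpow hlogb.le hk₀.le]
  refine Real.rpow_le_rpow_of_nonpos (by positivity) ?_ (by linarith)
  rw [mul_comm, ← Real.log_pow]
  exact Real.log_le_log (by positivity) (hc k)

end Rate

section Growth

variable {u : ℕ → ℝ}

lemma tendsto_sum_atTop_of_tendsto_div {α β : ℝ} (hα : 0 < α) (hβ : 0 < β)
    (hgrowth : Tendsto (fun N : ℕ => (∑ n ∈ Finset.range N, u n) /
      ((N : ℝ) ^ α * Real.log N ^ β)) atTop atTop) :
    Tendsto (fun N => ∑ n ∈ Finset.range N, u n) atTop atTop := by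
  have hscale : Tendsto (fun N : ℕ => (N : ℝ) ^ α * Real.log N ^ β) atTop atTop :=
    ((tendsto_rpow_atTop hα).comp tendsto_natCast_atTop_atTop).atTop_mul_atTop₀
      ((tendsto_rpow_atTop hβ).comp tendsto_log_natCast_atTop)
  refine (hgrowth.atTop_mul_atTop₀ hscale).congr' ?_
  filter_upwards [hscale.eventually_ne_atTop 0] with N hN
  exact div_mul_cancel₀ _ hN

lemma half_mul_le_sum_of_antitoneOn (hu : ∀ n, 0 ≤ u n) (hmono : AntitoneOn u (Set.Ici 1))
    {N : ℕ} (hN : 2 ≤ N) : (N : ℝ) / 2 * u N ≤ ∑ n ∈ Finset.range N, u n := by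
  have hN' : (2 : ℝ) ≤ N := by exact_mod_cast hN
  calc (N : ℝ) / 2 * u N
      ≤ ((N - 1 : ℕ) : ℝ) * u N := by
        gcongr
        · exact hu N
        · rw [Nat.cast_sub (by omega)]
          push_cast
          linarith
    _ = ∑ _ ∈ Finset.Ico 1 N, u N := by rw [Finset.sum_const, Nat.card_Ico, nsmul_eq_mul]
    _ ≤ ∑ n ∈ Finset.Ico 1 N, u n := Finset.sum_le_sum fun n hn => by
        obtain ⟨hn₁, hnN⟩ := Finset.mem_Ico.1 hn
        exact hmono hn₁ (hn₁.trans hnN.le) hnN.le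
    _ ≤ ∑ n ∈ Finset.range N, u n := by
        rw [Finset.range_eq_Ico]
        exact Finset.sum_le_sum_of_subset_of_nonneg (Finset.Ico_subset_Ico_left zero_le_one)
          fun n _ _ => hu n

lemma tendsto_sum_div_atTop_of_antitoneOn (hu : ∀ n, 0 ≤ u n) (hmono : AntitoneOn u (Set.Ici 1))
    {α β : ℝ} (hαβ : α + β = 1) {g : ℕ → ℝ} (hg : ∀ n, 0 ≤ g n)
    (hgrowth : Tendsto (fun n : ℕ => u n * ((n : ℝ) ^ α / g n)) atTop atTop) :
    Tendsto (fun N : ℕ => (∑ n ∈ Finset.range N, u n) / ((N : ℝ) ^ β * g N)) atTop atTop := by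
  refine tendsto_atTop_mono' _ ?_ (hgrowth.atTop_div_const two_pos)
  filter_upwards [eventually_ge_atTop 2] with N hN
  have hN₀ : (0 : ℝ) < N := by positivity
  have hsplit : (N : ℝ) = N ^ β * N ^ α := by
    rw [← Real.rpow_add hN₀, add_comm β, hαβ, Real.rpow_one]
  calc u N * ((N : ℝ) ^ α / g N) / 2
      = (N : ℝ) ^ β * (N ^ α / 2 * u N) / (N ^ β * g N) := by
        rw [mul_div_mul_left _ _ (Real.rpow_pos_of_pos hN₀ β).ne']
        ring
    _ = (N : ℝ) / 2 * u N / (N ^ β * g N) := by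
        rw [← mul_assoc, ← mul_div_assoc, ← hsplit]
    _ ≤ (∑ n ∈ Finset.range N, u n) / ((N : ℝ) ^ β * g N) :=
        div_le_div_of_nonneg_right (half_mul_le_sum_of_antitoneOn hu hmono hN)
          (mul_nonneg (Real.rpow_nonneg hN₀.le β) (hg N))

end Growth

theorem theoremD_general {Ω : Type*} [MeasurableSpace Ω] {P : Measure Ω} {ℓ : ℕ} (hℓ : 1 ≤ ℓ)
    {u : ℕ → ℝ} {U : ℕ → Ω → ℝ} (hU : IsRandomIndicator P u U) {δ : ℝ} (hδ : 0 < δ)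
    (hgrowth : Tendsto (fun N : ℕ => (∑ n ∈ Finset.range N, u n) /
      ((N : ℝ) ^ ((ℓ : ℝ) / (ℓ + 1)) * Real.log N ^ (2 + δ))) atTop atTop) :
    ∀ᵐ ω ∂P, ∀ (X : Type*) [MeasurableSpace X] (μ : Measure X) [IsFiniteMeasure μ]
      (T : X → X), MeasurePreserving T μ μ →
      ∀ F : Fin ℓ → X → ℂ, (∀ j, Measurable (F j)) → (∀ j, ∃ C : ℝ, ∀ x, ‖F j x‖ ≤ C) →
        ∀ᵐ x ∂μ, Tendsto (fun N : ℕ => differenceAverage T F (fun n => U n ω) u N x)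
          atTop (𝓝 0) := by
  have hw := tendsto_sum_atTop_of_tendsto_div (by positivity) (by positivity) hgrowth
  have hrate : Tendsto (fun N : ℕ => logRate δ N ^ 2 * (∑ n ∈ Finset.range N, u n) /
      (N : ℝ) ^ ((ℓ : ℝ) / (ℓ + 1))) atTop atTop :=
    hgrowth.congr fun N => by rw [logRate_sq, inv_mul_eq_div, div_div, mul_comm]
  filter_upwards [hU.ae_eventually_hasShiftedProgressionBound hℓ (logRate_nonneg δ)
    ((tendsto_logRate hδ).eventually_le_const one_pos) hrate] with ω hω
  intro X _ μ _ T hT F hF hF_bdd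
  exact ae_tendsto_differenceAverage (fun n => hU.nonneg n ω) hU.prob_nonneg hw
    (tendsto_logRate hδ)
    (fun b hb => summable_logRate_of_pow_le hδ hb fun k =>
      (le_apply_firstPassage hw _).trans (hU.sum_prob_le _))
    hω hT hF hF_bdd

theorem theoremD {Ω : Type*} [MeasurableSpace Ω] (P : Measure Ω) [IsProbabilityMeasure P]
    (ℓ : ℕ) (hℓ : 1 ≤ ℓ)
    (u : ℕ → ℝ) (U : ℕ → Ω → ℝ) (hU : IsRandomIndicator P u U)
    (hmono : AntitoneOn u (Set.Ici 1))
    (δ : ℝ) (hδ : 0 < δ)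
    (hgrowth : Tendsto
      (fun n : ℕ => u n * ((n : ℝ) ^ ((1 : ℝ) / ((ℓ : ℝ) + 1)) / Real.log (n : ℝ) ^ (2 + δ)))
      atTop atTop) :
    ∀ᵐ ω ∂P, ∀ (X : Type*) [MeasurableSpace X] (μ : Measure X) [IsProbabilityMeasure μ]
      (T : X → X), MeasurePreserving T μ μ →
      ∀ F : Fin ℓ → X → ℂ, (∀ j, Measurable (F j)) → (∀ j, ∃ C : ℝ, ∀ x, ‖F j x‖ ≤ C) →
        ∀ᵐ x ∂μ, Tendsto (fun N : ℕ => differenceAverage T F (fun n => U n ω) u N x)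
          atTop (𝓝 0) := by
  have hsum := tendsto_sum_div_atTop_of_antitoneOn hU.prob_nonneg hmono
    (by field_simp; ring : 1 / ((ℓ : ℝ) + 1) + ℓ / (ℓ + 1) = 1)
    (fun n => Real.rpow_nonneg (Real.log_natCast_nonneg n) _) hgrowth
  filter_upwards [theoremD_general hℓ hU hδ hsum] with ω hω
  exact fun X _ μ _ => hω X μ
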